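/- Let $\mathrm{DNF}_n$ be the class of Boolean functions on $\{0,1\}^n$ that are computed by DNF formulas of size at most $n$, where the size of a DNF formula is its number of terms. For a distribution $D$ over a set $X$, $k\in\mathbb N$ and $\tau>0$, a $k$-wise statistical query oracle $\mathsf{STAT}^{(k)}_D(\tau)$ answers every query $\phi:X^k\to[-1,1]$ with some value $v$ such that $|v-\mathbb E_{x\sim D^k}[\phi(x)]|\le\tau$. A (possibly randomized and adaptive) algorithm with access to $\mathsf{STAT}^{(k)}(\tau)$ PAC learns $\mathrm{DNF}_n$ with error $<\epsilon$ and success probability at least $2/3$ if for every distribution $P$ over $\{0,1\}^n$, every $f\in\mathrm{DNF}_n$ and every valid oracle $\mathsf{STAT}^{(k)}_{P^f}(\tau)$, where $P^f$ is the distribution of $(x,f(x))$ for $x\sim P$, it outputs, with probability at least $2/3$ over its internal randomness, a hypothesis $h:\{0,1\}^n\to\{0,1\}$ with $\Pr_{x\sim P}[h(x)\ne f(x)]<\epsilon$. Theorem. For every constant $\alpha>0$ there is a constant $\beta>0$ such that for every integer $n\ge 1$, any algorithm that, with access to $\mathsf{STAT}^{(k)}(n^{-\beta\log_2 n})$ for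 $k=\lceil n^{1-\alpha}\rceil$, PAC learns $\mathrm{DNF}_n$ with error $<1/2-n^{-\beta\log_2 n}$ and success probability at least $2/3$ needs at least $2^{n^{1-\alpha}}$ queries: if it never asks more than $q$ queries, then $q\ge 2^{n^{1-\alpha}}$. -/

import Mathlib

open MeasureTheory

noncomputable section

/-! ### DNF formulas -/

/-- A DNF formula over the Boolean variables `x 0, …, x (n-1)`: a finite set of terms, each term
being a finite set of literals; the literal `(i, b)` is satisfied by `x` iff `x i = b`. -/
abbrev DNF (n : ℕ) : Type := Finset (Finset (Fin n × Bool))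

namespace DNF

/-- The size of a DNF formula is its number of terms. -/
def size {n : ℕ} (F : DNF n) : ℕ := F.card

/-- The Boolean function computed by a DNF formula (a disjunction of conjunctions). -/
def eval {n : ℕ} (F : DNF n) (x : Fin n → Bool) : Bool :=
  decide (∃ t ∈ F, ∀ l ∈ t, x l.1 = l.2)

/-- The concept class of functions on `{0,1}^n` computed by DNF formulas of size at most `s`. -/
def conceptClass (n s : ℕ) : Set ((Fin n → Bool) → Bool) :=
  {f | ∃ F : DNF n, F.size ≤ s ∧ F.eval = f}

end DNF

/-! ### `k`-wise statistical queries -/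

/-- A `k`-wise query function `X^k → [-1, 1]`. -/
abbrev KWiseQuery (X : Type) (k : ℕ) : Type := (Fin k → X) → Set.Icc (-1 : ℝ) 1

/-- `O` is a `k`-wise statistical query oracle for the distribution `D` with tolerance `τ`:
it answers every query `φ` by some value within `τ` of the expectation of `φ` under `D^k`. -/
def IsSTAT {X : Type} [MeasurableSpace X] (k : ℕ) (D : Measure X) (τ : ℝ)
    (O : KWiseQuery X k → ℝ) : Prop :=
  ∀ φ : KWiseQuery X k, |O φ - ∫ x, (φ x : ℝ) ∂(Measure.pi fun _ : Fin k => D)| ≤ τ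

/-- A deterministic adaptive algorithm that asks `k`-wise queries over `X` and outputs an element
of `H`: either it stops with an output, or it asks a query and continues according to the answer.
There is no restriction on the computation between queries. -/
inductive SQAlg (X : Type) (k : ℕ) (H : Type) : Type
  | output (h : H) : SQAlg X k H
  | query (φ : KWiseQuery X k) (next : ℝ → SQAlg X k H) : SQAlg X k H

namespace SQAlg

/-- The output of the algorithm when its queries are answered by `O`. -/
def run {X : Type} {k : ℕ} {H : Type} (O : KWiseQuery X k → ℝ) : SQAlg X k H → H
  | output h => h
  | query φ next => run O (next (O φ))

/-- The number of queries asked by the algorithm when its queries are answered by `O`. -/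
def numQueries {X : Type} {k : ℕ} {H : Type} (O : KWiseQuery X k → ℝ) : SQAlg X k H → ℕ
  | output _ => 0
  | query φ next => numQueries O (next (O φ)) + 1

end SQAlg

/-! ### PAC learning from `k`-wise statistical queries -/

/-- The distribution of the labeled example `(x, f x)` for `x ∼ P`. -/
def labeled {Z : Type} [MeasurableSpace Z] (P : Measure Z) (f : Z → Bool) : Measure (Z × Bool) :=
  P.map fun x => (x, f x)

/-- A randomized algorithm is a family `A` of deterministic algorithms indexed by the random seed
`ω ∼ μ`. It PAC learns the class `C` over `Z` from `k`-wise queries of tolerance `τ`, with error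
`< ε` and success probability at least `p`, if for every distribution `P` on `Z`, every target
`f ∈ C` and every valid oracle for the labeled examples, with probability at least `p` over the
seed the output hypothesis `h` satisfies `Pr_{x ∼ P}[h x ≠ f x] < ε`.
(The event `E` is there only so that measurability of the exact success event is not needed.) -/
def PACLearns {Z : Type} [MeasurableSpace Z] {Ω : Type*} [MeasurableSpace Ω] {k : ℕ}
    (C : Set (Z → Bool)) (τ ε p : ℝ) (μ : Measure Ω)
    (A : Ω → SQAlg (Z × Bool) k (Z → Bool)) : Prop :=
  ∀ (P : Measure Z) [IsProbabilityMeasure P], ∀ f ∈ C, ∀ O : KWiseQuery (Z × Bool) k → ℝ,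
    IsSTAT k (labeled P f) τ O →
      ∃ E : Set Ω, MeasurableSet E ∧ p ≤ μ.real E ∧
        ∀ ω ∈ E, P.real {x | (A ω).run O x ≠ f x} < ε

/-- On every input distribution `(x, f x)`, `x ∼ P`, `f ∈ C`, with every valid oracle of tolerance
`τ`, and for every seed, the algorithm asks at most `q` queries. -/
def UsesAtMost {Z : Type} [MeasurableSpace Z] {Ω : Type*} {k : ℕ}
    (C : Set (Z → Bool)) (τ : ℝ) (A : Ω → SQAlg (Z × Bool) k (Z → Bool)) (q : ℕ) : Prop :=
  ∀ (P : Measure Z) [IsProbabilityMeasure P], ∀ f ∈ C, ∀ O : KWiseQuery (Z × Bool) k → ℝ,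
    IsSTAT k (labeled P f) τ O → ∀ ω, (A ω).numQueries O ≤ q

end

/-! The hard targets are block parities. Take `r = ⌊log₂ n⌋` blocks of `m = ⌊n / r⌋` variables and a
secret bit `s j i` for each variable. An input encodes one chosen index `c j` per block, and its
label is the parity of the bits `s j (c j)`. Listing the at most `2 ^ r ≤ n` odd patterns of these
bits gives a DNF (`BlockParity.boolSign_eval_formula`).

For a random secret, the correlation of the label with a bounded function is a multilinear form in
independent signs. Its moments are dominated by those of a product of `r` Rademacher sums
(`sum_pow_multilinear_boolSign_le`), so the `2t`-th moment is at most `(12t/m)^(tr)`. A hybrid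
argument over the samples carries this to `k`-sample queries at the cost of a factor `k^(2t) 2^k`
(`sum_pow_prodExpect_sub_le`). With `t = k`, Markov's inequality shows that a query distinguishes
the labels from fair coin flips for at most a `16^(-k)` fraction of the secrets.

An oracle may therefore answer as if the labels were coin flips until a query hits the secret, and
each query rules out few secrets. A hypothesis beating error `1/2 - τ` would itself yield a
distinguishing query, which gives `2/3 ≤ (q + 1) 16^(-k)` (`PACLearns.le_mul_of_separation`). For
the finitely many small `n`, `β` is so small that the required error is nonpositive. -/

/-! ### Moments of Rademacher sums and multilinear forms -/

/-- The sign `(-1)^b` of a bit. -/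
def boolSign (b : Bool) : ℝ := if b then -1 else 1

/-- The sum factors over coordinates; a coordinate of even multiplicity contributes `2`, one of odd
multiplicity `0`. -/
theorem sum_prod_boolSign_nonneg {ι κ : Type*} [Fintype ι] [DecidableEq ι] [Fintype κ]
    (c : κ → ι) : 0 ≤ ∑ u : ι → Bool, ∏ a, boolSign (u (c a)) := by
  classical
  have h : ∀ u : ι → Bool, ∏ a, boolSign (u (c a)) =
      ∏ i, boolSign (u i) ^ (Finset.univ.filter fun a => c a = i).card := by
    intro u
    rw [← Finset.prod_fiberwise Finset.univ c]
    refine Finset.prod_congr rfl fun i _ => ?_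
    rw [Finset.prod_congr rfl (g := fun _ => boolSign (u i)), Finset.prod_const]
    intro a ha
    rw [(Finset.mem_filter.1 ha).2]
  simp_rw [h]
  rw [← Fintype.prod_sum fun i b => boolSign b ^ (Finset.univ.filter fun a => c a = i).card]
  refine Finset.prod_nonneg fun i _ => ?_
  rw [Fintype.sum_bool]
  rcases neg_one_pow_eq_or ℝ (Finset.univ.filter fun a => c a = i).card with h | h <;>
    simp [boolSign, h]

/-- After expanding the power, every monomial has a nonnegative sum over the signs, so replacing all
coefficients by `1` can only increase the total. The all-ones form is a product of independent
Rademacher sums. -/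
theorem sum_pow_multilinear_boolSign_le {ι κ : Type*} [Fintype ι] [DecidableEq ι] [Fintype κ]
    [DecidableEq κ] (ψ : (ι → κ) → ℝ) (hψ : ∀ c, |ψ c| ≤ 1) (p : ℕ) :
    ∑ s : ι → κ → Bool, (∑ c : ι → κ, ψ c * ∏ j, boolSign (s j (c j))) ^ p ≤
      (∑ u : κ → Bool, (∑ i, boolSign (u i)) ^ p) ^ Fintype.card ι := by
  have expand : ∀ θ : (ι → κ) → ℝ,
      ∑ s : ι → κ → Bool, (∑ c : ι → κ, θ c * ∏ j, boolSign (s j (c j))) ^ p =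
        ∑ c : Fin p → ι → κ, (∏ a, θ (c a)) *
          ∏ j, ∑ u : κ → Bool, ∏ a, boolSign (u (c a j)) := by
    intro θ
    simp_rw [Fintype.sum_pow, Finset.prod_mul_distrib]
    rw [Finset.sum_comm]
    refine Finset.sum_congr rfl fun c _ => ?_
    rw [← Finset.mul_sum]
    congr 1
    rw [Fintype.prod_sum fun j (u : κ → Bool) => ∏ a, boolSign (u (c a j))]
    exact Finset.sum_congr rfl fun s _ => Finset.prod_comm
  calc _ ≤ ∑ s : ι → κ → Bool, (∑ c : ι → κ, (1 : ℝ) * ∏ j, boolSign (s j (c j))) ^ p := by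
        rw [expand, expand fun _ => 1]
        refine Finset.sum_le_sum fun c _ => mul_le_mul_of_nonneg_right ?_ ?_
        · refine (le_abs_self _).trans ?_
          rw [Finset.abs_prod]
          exact Finset.prod_le_prod (fun _ _ => abs_nonneg _) fun _ _ => hψ _
        · exact Finset.prod_nonneg fun j _ => sum_prod_boolSign_nonneg fun a => c a j
    _ = ∑ s : ι → κ → Bool, ∏ j, (∑ i, boolSign (s j i)) ^ p := by
        refine Finset.sum_congr rfl fun s _ => ?_
        rw [Finset.prod_pow, Fintype.prod_sum]
        simp
    _ = _ := by
        rw [← Fintype.prod_sum fun _ (u : κ → Bool) => (∑ i, boolSign (u i)) ^ p,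
          Finset.prod_const, Finset.card_univ]

theorem sum_exp_mul_sum_boolSign_le {κ : Type*} [Fintype κ] [DecidableEq κ] (l : ℝ) :
    ∑ u : κ → Bool, Real.exp (l * ∑ i, boolSign (u i)) ≤
      2 ^ Fintype.card κ * Real.exp (l ^ 2 / 2 * Fintype.card κ) := by
  simp_rw [Finset.mul_sum, Real.exp_sum]
  rw [← Fintype.prod_sum fun _ b => Real.exp (l * boolSign b), Finset.prod_const,
    Finset.card_univ, mul_comm (l ^ 2 / 2), Real.exp_nat_mul, ← mul_pow]
  have h := Real.cosh_le_exp_half_sq l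
  rw [Real.cosh_eq] at h
  refine pow_le_pow_left₀ (by positivity) ?_ _
  simp only [Fintype.sum_bool, boolSign]
  norm_num
  linarith

/-- An even-moment Khintchine inequality for sums of independent signs. -/
theorem sum_pow_sum_boolSign_le {κ : Type*} [Fintype κ] [DecidableEq κ] [Nonempty κ]
    (t : ℕ) (ht : 1 ≤ t) :
    ∑ u : κ → Bool, (∑ i, boolSign (u i)) ^ (2 * t) ≤
      2 ^ Fintype.card κ * (12 * t * Fintype.card κ) ^ t := by
  set m : ℝ := ((Fintype.card κ : ℕ) : ℝ) with hm
  have hm0 : 0 < m := by simp [hm, Fintype.card_pos]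
  have ht0 : (0 : ℝ) < t := by exact_mod_cast ht
  -- This scale turns the sub-Gaussian bound `exp (l² m / 2)` into `exp t`.
  set l : ℝ := Real.sqrt (2 * t / m)
  have hl2 : l ^ 2 = 2 * t / m := Real.sq_sqrt (by positivity)
  have hl0 : 0 < l := Real.sqrt_pos.2 (by positivity)
  have key : ∀ x : ℝ, (l * x) ^ (2 * t) ≤
      (2 * t).factorial * (Real.exp (l * x) + Real.exp (-l * x)) := by
    intro x
    have h1 := Real.pow_div_factorial_le_exp |l * x| (abs_nonneg _) (2 * t)
    rw [(even_two_mul t).pow_abs, div_le_iff₀' (by positivity)] at h1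
    refine h1.trans (mul_le_mul_of_nonneg_left ?_ (by positivity))
    rcases abs_cases (l * x) with ⟨h, _⟩ | ⟨h, _⟩ <;> rw [h]
    · linarith [Real.exp_pos (-l * x)]
    · rw [neg_mul]; linarith [Real.exp_pos (l * x)]
  have hsum : l ^ (2 * t) * ∑ u : κ → Bool, (∑ i, boolSign (u i)) ^ (2 * t) ≤
      (2 * t).factorial * (2 * (2 ^ Fintype.card κ * Real.exp t)) := by
    have h1 := sum_exp_mul_sum_boolSign_le (κ := κ) l
    have h2 := sum_exp_mul_sum_boolSign_le (κ := κ) (-l)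
    have e : l ^ 2 / 2 * m = t := by rw [hl2]; field_simp
    rw [neg_sq, e] at h2
    rw [e] at h1
    rw [Finset.mul_sum]
    simp_rw [← mul_pow]
    refine (Finset.sum_le_sum fun u _ => key _).trans ?_
    rw [← Finset.mul_sum, Finset.sum_add_distrib]
    exact mul_le_mul_of_nonneg_left (by linarith) (by positivity)
  have hf : ((2 * t).factorial : ℝ) ≤ (2 * t) ^ (2 * t) := by
    exact_mod_cast Nat.factorial_le_pow (2 * t)
  have he : Real.exp t ≤ 3 ^ t := by
    rw [← mul_one (t : ℝ), Real.exp_nat_mul]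
    exact pow_le_pow_left₀ (Real.exp_pos _).le Real.exp_one_lt_three.le _
  have h2t : (2 : ℝ) ≤ 2 ^ t := by
    simpa using pow_le_pow_right₀ (one_le_two (α := ℝ)) ht
  refine le_of_mul_le_mul_left (hsum.trans ?_) (pow_pos hl0 (2 * t))
  -- Dividing `(2t)^(2t) * 2^t * 3^t` by `l^(2t) = (2t/m)^t` leaves `(12tm)^t`.
  calc ((2 * t).factorial : ℝ) * (2 * (2 ^ Fintype.card κ * Real.exp t))
      ≤ (2 * t) ^ (2 * t) * (2 ^ t * (2 ^ Fintype.card κ * 3 ^ t)) := by gcongr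
    _ = _ := by
        have e : 2 * t / m * (12 * t * m) = (2 * t : ℝ) ^ 2 * 2 * 3 := by field_simp; norm_num
        rw [pow_mul l, hl2, pow_mul, mul_left_comm ((2 * t / m : ℝ) ^ t), ← mul_pow, e,
          mul_pow _ (3 : ℝ), mul_pow _ (2 : ℝ)]
        ring

/-! ### From single-sample to multi-sample queries -/

/-- The expectation of `φ` under `k` independent draws from the weights `d`. -/
def prodExpect {Y : Type*} [Fintype Y] (d : Y → ℝ) (k : ℕ) (φ : (Fin k → Y) → ℝ) : ℝ :=
  ∑ y : Fin k → Y, (∏ a, d (y a)) * φ y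

theorem prodExpect_succ {Y : Type*} [Fintype Y] (d : Y → ℝ) (k : ℕ) (φ : (Fin (k + 1) → Y) → ℝ) :
    prodExpect d (k + 1) φ = ∑ z, d z * prodExpect d k fun y => φ (Fin.cons z y) := by
  unfold prodExpect
  rw [← (Fin.consEquiv fun _ => Y).sum_comp, Fintype.sum_prod_type]
  refine Finset.sum_congr rfl fun z _ => ?_
  rw [Finset.mul_sum]
  refine Finset.sum_congr rfl fun y _ => ?_
  simp [Fin.consEquiv, Fin.prod_univ_succ, mul_assoc]

theorem abs_prodExpect_le_one {Y : Type*} [Fintype Y] {d : Y → ℝ} (hd : ∀ y, 0 ≤ d y)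
    (hd1 : ∑ y, d y = 1) {k : ℕ} {φ : (Fin k → Y) → ℝ} (hφ : ∀ y, |φ y| ≤ 1) :
    |prodExpect d k φ| ≤ 1 := by
  have hp : ∀ y : Fin k → Y, 0 ≤ ∏ a, d (y a) := fun y => Finset.prod_nonneg fun a _ => hd _
  calc |prodExpect d k φ| ≤ ∑ y : Fin k → Y, |(∏ a, d (y a)) * φ y| := Finset.abs_sum_le_sum_abs _ _
    _ ≤ ∑ y : Fin k → Y, ∏ a, d (y a) := by
        refine Finset.sum_le_sum fun y _ => ?_
        rw [abs_mul, abs_of_nonneg (hp y)]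
        exact mul_le_of_le_one_right (hp y) (hφ y)
    _ = 1 := by rw [← Fintype.sum_pow, hd1, one_pow]

/-- Convexity with weights in ratio `K : 1`, chosen so that a factor `K ^ p` in the bound for `a ^
p` grows only to `(K + 1) ^ p` in the hybrid induction. -/
theorem add_pow_le_of_even {p : ℕ} (hp : Even p) {K : ℝ} (hK : 0 < K) (a b : ℝ) :
    (a + b) ^ p ≤ (K + 1) ^ p * (K / (K + 1) * (a / K) ^ p + 1 / (K + 1) * b ^ p) := by
  have h := (hp.convexOn_pow (𝕜 := ℝ)).2 (Set.mem_univ (a / K)) (Set.mem_univ b)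
    (show 0 ≤ K / (K + 1) by positivity) (show 0 ≤ 1 / (K + 1) by positivity) (by field_simp)
  simp only [smul_eq_mul] at h
  calc (a + b) ^ p = (K + 1) ^ p * (K / (K + 1) * (a / K) + 1 / (K + 1) * b) ^ p := by
        rw [← mul_pow]; congr 1; field_simp
    _ ≤ _ := by gcongr

/-- If the weights `d s` are dominated by `2 * d₀`, a moment bound (over `s`) for the deviation of
single-sample queries passes to `k`-sample queries. -/
theorem sum_pow_prodExpect_sub_le {S Y : Type*} [Fintype S] [Fintype Y] {d : S → Y → ℝ}
    {d₀ : Y → ℝ} (hd : ∀ s y, 0 ≤ d s y) (hd1 : ∀ s, ∑ y, d s y = 1) (hd₀ : ∀ y, 0 ≤ d₀ y)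
    (hd₀1 : ∑ y, d₀ y = 1) (hle : ∀ s y, d s y ≤ 2 * d₀ y) {p : ℕ} (hp : Even p) (hp0 : p ≠ 0)
    {B : ℝ} (hB : ∀ ψ : Y → ℝ, (∀ y, |ψ y| ≤ 1) → ∑ s, (∑ y, (d s y - d₀ y) * ψ y) ^ p ≤ B)
    (k : ℕ) : ∀ φ : (Fin k → Y) → ℝ, (∀ y, |φ y| ≤ 1) →
      ∑ s, (prodExpect (d s) k φ - prodExpect d₀ k φ) ^ p ≤ (k : ℝ) ^ p * 2 ^ k * B := by
  have hB0 : 0 ≤ B := (Finset.sum_nonneg fun s _ => hp.pow_nonneg _).trans (hB (fun _ => 0) (by simp))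
  induction k with
  | zero =>
    intro φ _
    simp [prodExpect, hp0]
  | succ k ih =>
    intro φ hφ
    -- Hybrid step: `a` exchanges the last `k` samples while the first is drawn from `d s`; `b`
    -- exchanges the first while the others are drawn from `d₀`.
    set a : S → ℝ := fun s => ∑ z, d s z *
      (prodExpect (d s) k (fun y => φ (Fin.cons z y)) -
        prodExpect d₀ k fun y => φ (Fin.cons z y)) with ha
    set b : S → ℝ := fun s => ∑ z, (d s z - d₀ z) * prodExpect d₀ k fun y => φ (Fin.cons z y) with hb
    have hab : ∀ s, prodExpect (d s) (k + 1) φ - prodExpect d₀ (k + 1) φ = a s + b s := by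
      intro s
      simp only [prodExpect_succ, ha, hb]
      rw [← Finset.sum_sub_distrib, ← Finset.sum_add_distrib]
      exact Finset.sum_congr rfl fun z _ => by ring
    have hbB : ∑ s, b s ^ p ≤ B :=
      hB _ fun z => abs_prodExpect_le_one hd₀ hd₀1 fun y => hφ _
    have haB : ∑ s, a s ^ p ≤ 2 * ((k : ℝ) ^ p * 2 ^ k * B) := by
      -- Jensen moves the power inside. Domination then makes the weights independent of `s`, so the
      -- induction hypothesis applies for each `z`; each sample costs a factor `2`.
      calc ∑ s, a s ^ p ≤ ∑ s, ∑ z, (2 * d₀ z) *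
            (prodExpect (d s) k (fun y => φ (Fin.cons z y)) -
              prodExpect d₀ k fun y => φ (Fin.cons z y)) ^ p := by
            refine Finset.sum_le_sum fun s _ => ?_
            refine (Real.pow_arith_mean_le_arith_mean_pow_of_even _ _ _ (fun z _ => hd s z) (hd1 s)
              hp).trans (Finset.sum_le_sum fun z _ => ?_)
            exact mul_le_mul_of_nonneg_right (hle s z) (hp.pow_nonneg _)
        _ = ∑ z, (2 * d₀ z) * ∑ s, (prodExpect (d s) k (fun y => φ (Fin.cons z y)) -
              prodExpect d₀ k fun y => φ (Fin.cons z y)) ^ p := by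
            rw [Finset.sum_comm]
            simp_rw [Finset.mul_sum]
        _ ≤ ∑ z, (2 * d₀ z) * ((k : ℝ) ^ p * 2 ^ k * B) :=
            Finset.sum_le_sum fun z _ => mul_le_mul_of_nonneg_left (ih _ fun y => hφ _)
              (by linarith [hd₀ z])
        _ = _ := by rw [← Finset.sum_mul, ← Finset.mul_sum, hd₀1, mul_one]
    simp_rw [hab]
    rcases Nat.eq_zero_or_pos k with rfl | hk
    · have : ∀ s, a s = 0 := fun s => by simp [ha, prodExpect]
      simp only [this, zero_add]
      simp
      linarith
    · have hK : (0 : ℝ) < k := by exact_mod_cast hk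
      calc ∑ s, (a s + b s) ^ p
          ≤ ∑ s, ((k : ℝ) + 1) ^ p * (k / (k + 1) * (a s / k) ^ p + 1 / (k + 1) * b s ^ p) :=
            Finset.sum_le_sum fun s _ => add_pow_le_of_even hp hK _ _
        _ = ((k : ℝ) + 1) ^ p * (k / (k + 1) * ((∑ s, a s ^ p) / k ^ p) +
              1 / (k + 1) * ∑ s, b s ^ p) := by
            simp_rw [div_pow]
            rw [← Finset.mul_sum, Finset.sum_add_distrib, ← Finset.mul_sum, ← Finset.mul_sum,
              Finset.sum_div]
        _ ≤ ((k : ℝ) + 1) ^ p * (k / (k + 1) * (2 ^ (k + 1) * B) +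
              1 / (k + 1) * (2 ^ (k + 1) * B)) := by
            gcongr
            · rw [div_le_iff₀ (by positivity)]
              refine haB.trans (le_of_eq ?_)
              ring
            · exact hbB.trans (le_mul_of_one_le_left hB0 (one_le_pow₀ one_le_two))
        _ = _ := by
            push_cast
            field_simp

/-! ### Query lower bounds for learning -/

/-- The first `q` queries asked by the algorithm when its queries are answered by `O`. -/
def SQAlg.queryPath {X : Type} {k : ℕ} {H : Type} (O : KWiseQuery X k → ℝ) :
    ℕ → SQAlg X k H → List (KWiseQuery X k)
  | 0, _ => []
  | _ + 1, .output _ => []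
  | q + 1, .query φ next => φ :: queryPath O q (next (O φ))

theorem SQAlg.length_queryPath_le {X : Type} {k : ℕ} {H : Type} (O : KWiseQuery X k → ℝ) (q : ℕ) :
    ∀ a : SQAlg X k H, (a.queryPath O q).length ≤ q := by
  induction q with
  | zero => intro a; simp [queryPath]
  | succ q ih =>
    intro a
    cases a with
    | output h => simp [queryPath]
    | query φ next => simpa [queryPath] using ih _

/-- The query bound is needed only for `O`. This matters because the reference oracle `O'` need not
be valid for any target. -/
theorem SQAlg.run_eq_of_agree {X : Type} {k : ℕ} {H : Type} {O O' : KWiseQuery X k → ℝ} (q : ℕ) :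
    ∀ a : SQAlg X k H, a.numQueries O ≤ q → (∀ φ ∈ a.queryPath O' q, O φ = O' φ) →
      a.run O = a.run O' := by
  induction q with
  | zero =>
    intro a ha _
    cases a with
    | output h => rfl
    | query φ next => simp [numQueries] at ha
  | succ q ih =>
    intro a ha h
    cases a with
    | output h => rfl
    | query φ next =>
      have hφ : O φ = O' φ := h φ (by simp [queryPath])
      simp only [numQueries, hφ, Nat.add_le_add_iff_right] at ha
      simp only [run, hφ]
      exact ih _ ha fun ψ hψ => h ψ (by simp [queryPath, hψ])

/-- If every query separates `O₀` from only a `δ` fraction of the targets `f s`, and a hypothesis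
that is `ε`-accurate for `f s` yields a query separating `O₀` from `f s`, then learning with success
probability `p` takes `p / δ - 1` queries. -/
theorem PACLearns.le_mul_of_separation {Z : Type} [MeasurableSpace Z] {Ω : Type*}
    [MeasurableSpace Ω] {k : ℕ} {C : Set (Z → Bool)} {τ ε p : ℝ} {μ : Measure Ω}
    [IsProbabilityMeasure μ] {A : Ω → SQAlg (Z × Bool) k (Z → Bool)} {q : ℕ}
    (hA : PACLearns C τ ε p μ A) (hq : UsesAtMost C τ A q) (hτ : 0 ≤ τ)
    {S : Type*} [Fintype S] [Nonempty S] (P : Measure Z) [IsProbabilityMeasure P]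
    (f : S → Z → Bool) (hf : ∀ s, f s ∈ C) (O₀ : KWiseQuery (Z × Bool) k → ℝ)
    (sep : KWiseQuery (Z × Bool) k → Finset S)
    (hsep : ∀ φ, ∀ s ∉ sep φ,
      |O₀ φ - ∫ x, (φ x : ℝ) ∂(Measure.pi fun _ : Fin k => labeled P (f s))| ≤ τ)
    {δ : ℝ} (hδ : ∀ φ, ((sep φ).card : ℝ) ≤ δ * Fintype.card S)
    (test : ∀ h : Z → Bool, ∃ φ, ∀ s ∉ sep φ, ε ≤ P.real {x | h x ≠ f s x}) :
    p ≤ (q + 1) * δ := by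
  classical
  -- The adversarial oracle reveals the truth only on queries that separate `s`, and hence stays
  -- valid for `f s`.
  let O : S → KWiseQuery (Z × Bool) k → ℝ := fun s φ =>
    if s ∈ sep φ then ∫ x, (φ x : ℝ) ∂(Measure.pi fun _ : Fin k => labeled P (f s)) else O₀ φ
  have hO : ∀ s, IsSTAT k (labeled P (f s)) τ (O s) := by
    intro s φ
    by_cases h : s ∈ sep φ
    · simpa [O, h] using hτ
    · simpa only [O, h, if_false] using hsep φ s h
  choose E hEm hEp hE using fun s => hA P (f s) (hf s) (O s) (hO s)
  choose t ht using test
  have hcount : ∀ ω, ((Finset.univ.filter fun s => ω ∈ E s).card : ℝ) ≤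
      (q + 1) * δ * Fintype.card S := by
    intro ω
    -- For a fixed seed, a secret missed by all of these queries sees the same output as under `O₀`,
    -- and that output is not accurate for it. The test of this output accounts for the `+ 1`.
    set l : List (KWiseQuery (Z × Bool) k) := t ((A ω).run O₀) :: (A ω).queryPath O₀ q with hl
    have hsub : (Finset.univ.filter fun s => ω ∈ E s) ⊆ l.toFinset.biUnion sep := by
      intro s hs
      by_contra hn
      simp only [Finset.mem_biUnion, List.mem_toFinset, not_exists, not_and] at hn
      have hrun : (A ω).run (O s) = (A ω).run O₀ := by
        refine SQAlg.run_eq_of_agree q _ (hq P (f s) (hf s) (O s) (hO s) ω) fun φ hφ => ?_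
        simp [O, hn φ (by simp [hl, hφ])]
      have h1 := hE s ω (Finset.mem_filter.1 hs).2
      rw [hrun] at h1
      exact absurd (ht _ s (hn _ (by simp [hl]))) (not_le.2 h1)
    have hlen : (l.toFinset.card : ℝ) ≤ q + 1 := by
      have h1 := l.toFinset_card_le
      have h2 := SQAlg.length_queryPath_le O₀ q (A ω)
      have h3 : l.length = ((A ω).queryPath O₀ q).length + 1 := by simp [hl]
      exact_mod_cast (by omega : l.toFinset.card ≤ q + 1)
    have hδ0 : 0 ≤ δ * Fintype.card S := (Nat.cast_nonneg _).trans (hδ (t ((A ω).run O₀)))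
    calc ((Finset.univ.filter fun s => ω ∈ E s).card : ℝ) ≤ (l.toFinset.biUnion sep).card := by
          exact_mod_cast Finset.card_le_card hsub
      _ ≤ ∑ φ ∈ l.toFinset, ((sep φ).card : ℝ) := by exact_mod_cast Finset.card_biUnion_le
      _ ≤ l.toFinset.card * (δ * Fintype.card S) := by
          simpa using Finset.sum_le_card_nsmul l.toFinset _ _ fun φ _ => hδ φ
      _ ≤ (q + 1) * (δ * Fintype.card S) := by gcongr
      _ = _ := by ring
  have hintegrable : ∀ s, Integrable ((E s).indicator fun _ => (1 : ℝ)) μ := fun s =>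
    (integrable_const 1).indicator (hEm s)
  -- Averaging over seeds turns the bound for each seed into one on the total success probability.
  have hsum : ∑ s, μ.real (E s) ≤ (q + 1) * δ * Fintype.card S := by
    calc ∑ s, μ.real (E s) = ∫ ω, ∑ s, (E s).indicator (fun _ => (1 : ℝ)) ω ∂μ := by
          rw [integral_finsetSum _ fun s _ => hintegrable s]
          refine Finset.sum_congr rfl fun s _ => ?_
          rw [integral_indicator_const _ (hEm s), smul_eq_mul, mul_one]
      _ ≤ ∫ _, (q + 1) * δ * Fintype.card S ∂μ := by
          refine integral_mono (integrable_finsetSum _ fun s _ => hintegrable s) (integrable_const _)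
            fun ω => ?_
          refine le_trans (le_of_eq ?_) (hcount ω)
          simp [Set.indicator_apply]
      _ = _ := by simp
  have hp : p * Fintype.card S ≤ ∑ s, μ.real (E s) := by
    have := Finset.card_nsmul_le_sum Finset.univ (fun s => μ.real (E s)) p fun s _ => hEp s
    simpa [mul_comm] using this
  have hS : (0 : ℝ) < Fintype.card S := by exact_mod_cast Fintype.card_pos
  exact le_of_mul_le_mul_right (hp.trans hsum) hS

theorem integral_pi_eq_prodExpect {X : Type} [Fintype X] [MeasurableSpace X]
    [MeasurableSingletonClass X] (D : Measure X) [IsProbabilityMeasure D] (k : ℕ)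
    (φ : (Fin k → X) → ℝ) :
    ∫ x, φ x ∂(Measure.pi fun _ : Fin k => D) = prodExpect (fun y => D.real {y}) k φ := by
  rw [integral_fintype Integrable.of_finite]
  refine Finset.sum_congr rfl fun x _ => ?_
  rw [smul_eq_mul, measureReal_def, Measure.pi_singleton, ENNReal.toReal_prod]
  rfl

theorem prodExpect_eval {Y : Type*} [Fintype Y] {d : Y → ℝ} (hd1 : ∑ y, d y = 1) {k : ℕ}
    (g : Y → ℝ) (i : Fin k) : prodExpect d k (fun y => g (y i)) = ∑ y, d y * g y := by
  have hconst : ∀ (k : ℕ) (c : ℝ), prodExpect d k (fun _ => c) = c := by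
    intro k c
    rw [prodExpect, ← Finset.sum_mul, ← Fintype.sum_pow, hd1, one_pow, one_mul]
  induction k with
  | zero => exact i.elim0
  | succ k ih =>
    rw [prodExpect_succ]
    refine Fin.cases ?_ (fun i => ?_) i
    · simp [hconst]
    · simp only [Fin.cons_succ]
      rw [ih i, ← Finset.sum_mul, hd1, one_mul]

theorem labeled_real_singleton {Z : Type} [MeasurableSpace Z] [DiscreteMeasurableSpace Z]
    (P : Measure Z) (f : Z → Bool) (y : Z × Bool) :
    (labeled P f).real {y} = if f y.1 = y.2 then P.real {y.1} else 0 := by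
  obtain ⟨x, b⟩ := y
  rw [labeled, map_measureReal_apply .of_discrete (measurableSet_singleton _)]
  have : (fun x => (x, f x)) ⁻¹' {(x, b)} = if f x = b then {x} else ∅ := by
    ext z
    split_ifs with h
    · simp only [Set.mem_preimage, Set.mem_singleton_iff, Prod.mk.injEq]
      exact ⟨fun h => h.1, fun hz => ⟨hz, hz ▸ h⟩⟩
    · simp only [Set.mem_preimage, Set.mem_singleton_iff, Prod.mk.injEq, Set.mem_empty_iff_false,
        iff_false]
      rintro ⟨rfl, h'⟩
      exact h h'
  rw [this]
  split_ifs <;> simp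

/-- Fixed input distribution `P`: if for every `[-1,1]`-bounded `ψ` the correlation of `f s` with `ψ`
has small `p`-th moment over `s`, then learning from `k`-wise queries takes many queries. -/
theorem PACLearns.le_mul_of_moment {Z : Type} [Fintype Z] [MeasurableSpace Z]
    [MeasurableSingletonClass Z] {Ω : Type*}
    [MeasurableSpace Ω] {k : ℕ} (hk : 0 < k) {C : Set (Z → Bool)} {τ p : ℝ} {μ : Measure Ω}
    [IsProbabilityMeasure μ] {A : Ω → SQAlg (Z × Bool) k (Z → Bool)} {q : ℕ}
    (hA : PACLearns C τ (1 / 2 - τ) p μ A) (hq : UsesAtMost C τ A q) (hτ : 0 < τ)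
    {S : Type*} [Fintype S] [Nonempty S] (P : Measure Z) [IsProbabilityMeasure P]
    (f : S → Z → Bool) (hf : ∀ s, f s ∈ C) {e : ℕ} (he : Even e) (he0 : e ≠ 0) {B : ℝ}
    (hB : ∀ ψ : Z → ℝ, (∀ x, |ψ x| ≤ 1) →
      ∑ s, (∫ x, ψ x * boolSign (f s x) ∂P) ^ e ≤ B * Fintype.card S) :
    p ≤ (q + 1) * ((k : ℝ) ^ e * 2 ^ k * B / τ ^ e) := by
  classical
  let d : S → Z × Bool → ℝ := fun s y => (labeled P (f s)).real {y}
  -- The reference distribution attaches a fair coin as label; this gives domination by `2 * d₀` for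
  -- every target.
  let d₀ : Z × Bool → ℝ := fun y => P.real {y.1} / 2
  have hPr : ∀ s, IsProbabilityMeasure (labeled P (f s)) := fun s =>
    Measure.isProbabilityMeasure_map Measurable.of_discrete.aemeasurable
  have hP1 : ∑ x, P.real {x} = 1 := by
    simp
  have hdval : ∀ s y, d s y = if f s y.1 = y.2 then P.real {y.1} else 0 := fun s y =>
    labeled_real_singleton P (f s) y
  have hdsum : ∀ s (g : Z × Bool → ℝ), ∑ y, d s y * g y = ∑ x, P.real {x} * g (x, f s x) := by
    intro s g
    simp only [hdval, Fintype.sum_prod_type, ite_mul, zero_mul, Finset.sum_ite_eq, Finset.mem_univ,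
      if_true]
  have hd₀sum : ∀ g : Z × Bool → ℝ,
      ∑ y, d₀ y * g y = ∑ x, P.real {x} * ((g (x, true) + g (x, false)) / 2) := by
    intro g
    simp only [d₀, Fintype.sum_prod_type, Fintype.sum_bool]
    exact Finset.sum_congr rfl fun x _ => by ring
  have hd1 : ∀ s, ∑ y, d s y = 1 := fun s => by simpa [hP1] using hdsum s fun _ => 1
  have hd₀1 : ∑ y, d₀ y = 1 := by simpa [hP1] using hd₀sum fun _ => 1
  have hmoment := sum_pow_prodExpect_sub_le (d := d) (d₀ := d₀)
    (fun s y => measureReal_nonneg) hd1 (fun y => div_nonneg measureReal_nonneg zero_le_two) hd₀1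
    (fun s y => by
      rw [hdval]
      simp only [d₀]
      split_ifs <;> linarith [measureReal_nonneg (μ := P) (s := {y.1})])
    he he0 (B := B * Fintype.card S) (by
      intro ψ hψ
      -- The label-independent part of `ψ` cancels between `d s` and `d₀`; its odd part in the label
      -- remains, multiplied by the sign of the label.
      refine le_trans (le_of_eq ?_) (hB (fun x => (ψ (x, false) - ψ (x, true)) / 2) fun x => ?_)
      · refine Finset.sum_congr rfl fun s _ => ?_
        congr 1
        simp_rw [sub_mul]
        rw [Finset.sum_sub_distrib, hdsum, hd₀sum, integral_fintype Integrable.of_finite,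
          ← Finset.sum_sub_distrib]
        refine Finset.sum_congr rfl fun x _ => ?_
        cases f s x <;> simp [boolSign] <;> ring
      · have h1 := abs_le.1 (hψ (x, false))
        have h2 := abs_le.1 (hψ (x, true))
        exact abs_le.2 ⟨by linarith, by linarith⟩) k
  let O₀ : KWiseQuery (Z × Bool) k → ℝ := fun φ => prodExpect d₀ k fun y => (φ y : ℝ)
  have hI : ∀ s (φ : KWiseQuery (Z × Bool) k),
      ∫ x, (φ x : ℝ) ∂(Measure.pi fun _ : Fin k => labeled P (f s)) =
        prodExpect (d s) k fun y => (φ y : ℝ) := fun s φ =>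
    integral_pi_eq_prodExpect (labeled P (f s)) k fun y => (φ y : ℝ)
  let sep : KWiseQuery (Z × Bool) k → Finset S := fun φ => Finset.univ.filter fun s =>
    τ < |O₀ φ - ∫ x, (φ x : ℝ) ∂(Measure.pi fun _ : Fin k => labeled P (f s))|
  refine hA.le_mul_of_separation hq hτ.le P f hf O₀ sep (fun φ s hs => ?_) (fun φ => ?_) fun h => ?_
  · simpa [sep] using hs
  · have hm := hmoment (fun y => (φ y : ℝ)) fun y => abs_le.2 (φ y).2
    have hmarkov : (sep φ).card * τ ^ e ≤
        ∑ s, ((prodExpect (d s) k fun y => (φ y : ℝ)) -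
          prodExpect d₀ k fun y => (φ y : ℝ)) ^ e := by
      rw [← nsmul_eq_mul]
      refine (Finset.card_nsmul_le_sum (sep φ) _ _ fun s hs => ?_).trans
        (Finset.sum_le_sum_of_subset_of_nonneg (Finset.subset_univ _) fun s _ _ => he.pow_nonneg _)
      have hs' := (Finset.mem_filter.1 hs).2
      rw [hI, abs_sub_comm] at hs'
      rw [← he.pow_abs (_ - _)]
      exact pow_le_pow_left₀ hτ.le hs'.le _
    rw [div_mul_eq_mul_div, le_div_iff₀ (pow_pos hτ e)]
    exact (hmarkov.trans hm).trans (le_of_eq (by ring))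
  -- The test query is the error indicator of `h` on the first sample. Its mean is `1/2` under
  -- coin-flip labels and the error of `h` under `f s`, so non-separation forces error at least `1/2
  -- - τ`.
  · let g : Z × Bool → Set.Icc (-1 : ℝ) 1 := fun y =>
      if h y.1 = y.2 then ⟨0, by norm_num⟩ else ⟨1, by norm_num⟩
    have hg : ∀ y, (g y : ℝ) = if h y.1 = y.2 then 0 else 1 := fun y => by
      simp only [g]; split_ifs <;> rfl
    refine ⟨fun x => g (x ⟨0, hk⟩), fun s hs => ?_⟩
    have hs' := not_lt.1 fun H => hs (Finset.mem_filter.2 ⟨Finset.mem_univ _, H⟩)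
    rw [hI] at hs'
    simp only [O₀] at hs'
    rw [prodExpect_eval hd₀1 (fun y => (g y : ℝ)), prodExpect_eval (hd1 s) (fun y => (g y : ℝ)),
      hdsum, hd₀sum] at hs'
    have e1 : ∑ x, P.real {x} * (((g (x, true) : ℝ) + g (x, false)) / 2) = 1 / 2 := by
      calc _ = ∑ x, P.real {x} * (1 / 2) := Finset.sum_congr rfl fun x _ => by
            rw [hg, hg]; cases h x <;> simp
        _ = _ := by rw [← Finset.sum_mul, hP1, one_mul]
    have e2 : ∑ x, P.real {x} * (g (x, f s x) : ℝ) = P.real {x | h x ≠ f s x} := by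
      rw [← mul_one (P.real {x | h x ≠ f s x}), ← smul_eq_mul,
        ← integral_indicator_const (1 : ℝ) (Set.toFinite _).measurableSet,
        integral_fintype Integrable.of_finite]
      refine Finset.sum_congr rfl fun x _ => ?_
      rw [hg, smul_eq_mul]
      by_cases hx : h x = f s x <;> simp [hx]
    rw [e1, e2] at hs'
    linarith [(abs_le.1 hs').2]

/-! ### Parities of block secrets as DNF formulas -/

namespace BlockParity

variable {n r m : ℕ}

/-- The variable that stands for index `i` of block `j`. -/
def var (h : r * m ≤ n) (j : Fin r) (i : Fin m) : Fin n :=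
  Fin.castLE h (finProdFinEquiv (j, i))

theorem var_inj (h : r * m ≤ n) {j j' : Fin r} {i i' : Fin m} :
    var h j i = var h j' i' ↔ j = j' ∧ i = i' := by
  simp [var]

/-- The choice of one index `c j` in each block `j`, encoded by `n` bits: exactly the chosen
variables are false. -/
def encode (h : r * m ≤ n) (c : Fin r → Fin m) : Fin n → Bool :=
  fun v => decide (∀ j, v ≠ var h j (c j))

theorem encode_var (h : r * m ≤ n) (c : Fin r → Fin m) (j : Fin r) (i : Fin m) :
    encode h c (var h j i) = true ↔ i ≠ c j := by
  simp only [encode, decide_eq_true_eq, ne_eq, var_inj, not_and]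
  exact ⟨fun H => H j rfl, fun H j' e => e ▸ H⟩

/-- The term which, on encodings, says that the secret bits at the chosen indices are `b`. -/
def blockTerm (h : r * m ≤ n) (s : Fin r → Fin m → Bool) (b : Fin r → Bool) :
    Finset (Fin n × Bool) :=
  (Finset.univ.filter fun ji : Fin r × Fin m => s ji.1 ji.2 ≠ b ji.1).image
    fun ji => (var h ji.1 ji.2, true)

/-- The only false variable of block `j` is the chosen one, so the term fails exactly when some
chosen index has a secret bit different from `b j`. -/
theorem blockTerm_satisfied_iff (h : r * m ≤ n) (s : Fin r → Fin m → Bool) (b : Fin r → Bool)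
    (c : Fin r → Fin m) :
    (∀ l ∈ blockTerm h s b, encode h c l.1 = l.2) ↔ b = fun j => s j (c j) := by
  simp only [blockTerm, Finset.mem_image, Finset.mem_filter, Finset.mem_univ, true_and,
    forall_exists_index, and_imp, Prod.forall]
  constructor
  · intro H
    funext j
    by_contra hne
    exact (encode_var h c j (c j)).1 (H _ _ j (c j) (fun e => hne e.symm) rfl) rfl
  · rintro rfl v b' j i hne heq
    obtain ⟨rfl, rfl⟩ := Prod.mk.inj heq
    exact (encode_var h c j i).2 fun e => hne (e ▸ rfl)

open Classical in
/-- A DNF formula that computes on encodings the parity of the chosen secret bits. -/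
noncomputable def formula (h : r * m ≤ n) (s : Fin r → Fin m → Bool) : DNF n :=
  (Finset.univ.filter fun b : Fin r → Bool => ∏ j, boolSign (b j) = -1).image (blockTerm h s)

theorem size_formula_le (h : r * m ≤ n) (s : Fin r → Fin m → Bool) :
    (formula h s).size ≤ 2 ^ r := by
  classical
  refine Finset.card_image_le.trans ((Finset.card_filter_le _ _).trans ?_)
  simp

theorem prod_boolSign_eq_or {ι : Type*} (t : Finset ι) (b : ι → Bool) :
    ∏ j ∈ t, boolSign (b j) = 1 ∨ ∏ j ∈ t, boolSign (b j) = -1 := by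
  classical
  induction t using Finset.induction_on with
  | empty => simp
  | insert a t ha ih =>
    rw [Finset.prod_insert ha]
    rcases ih with h | h <;> rw [h] <;> cases b a <;> simp [boolSign]

/-- On an encoding, only the pattern of the actual chosen bits can satisfy its term, and that term
is present exactly when the pattern is odd. -/
theorem boolSign_eval_formula (h : r * m ≤ n) (s : Fin r → Fin m → Bool) (c : Fin r → Fin m) :
    boolSign ((formula h s).eval (encode h c)) = ∏ j, boolSign (s j (c j)) := by
  classical
  have key : (∃ t ∈ formula h s, ∀ l ∈ t, encode h c l.1 = l.2) ↔
      ∏ j, boolSign (s j (c j)) = -1 := by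
    simp only [formula, Finset.mem_image, Finset.mem_filter, Finset.mem_univ, true_and]
    constructor
    · rintro ⟨_, ⟨b, hb, rfl⟩, H⟩
      rwa [(blockTerm_satisfied_iff h s b c).1 H] at hb
    · intro H
      exact ⟨_, ⟨_, H, rfl⟩, (blockTerm_satisfied_iff h s _ c).2 rfl⟩
  have heval : (formula h s).eval (encode h c) = decide (∏ j, boolSign (s j (c j)) = -1) :=
    decide_eq_decide.2 key
  rw [heval]
  rcases prod_boolSign_eq_or Finset.univ fun j => s j (c j) with h | h <;>
    simp only [h] <;> norm_num [boolSign]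

/-- The encoding of uniformly random indices. -/
noncomputable def inputs (h : r * m ≤ n) : Measure (Fin n → Bool) :=
  (ProbabilityTheory.uniformOn (Set.univ : Set (Fin r → Fin m))).map (encode h)

theorem isProbabilityMeasure_inputs (h : r * m ≤ n) (hm : 0 < m) :
    IsProbabilityMeasure (inputs h) := by
  have : Nonempty (Fin m) := ⟨⟨0, hm⟩⟩
  exact Measure.isProbabilityMeasure_map Measurable.of_discrete.aemeasurable

theorem integral_inputs (h : r * m ≤ n) (hm : 0 < m) (g : (Fin n → Bool) → ℝ) :
    ∫ x, g x ∂(inputs h) = ((m : ℝ) ^ r)⁻¹ * ∑ c, g (encode h c) := by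
  have : Nonempty (Fin m) := ⟨⟨0, hm⟩⟩
  rw [inputs, integral_map Measurable.of_discrete.aemeasurable
    (Measurable.of_discrete).aestronglyMeasurable, integral_fintype Integrable.of_finite,
    Finset.mul_sum]
  refine Finset.sum_congr rfl fun c _ => ?_
  rw [smul_eq_mul, measureReal_def, ProbabilityTheory.uniformOn_univ]
  simp

theorem sum_pow_integral_le (h : r * m ≤ n) (hm : 0 < m) {t : ℕ} (ht : 1 ≤ t)
    (ψ : (Fin n → Bool) → ℝ) (hψ : ∀ x, |ψ x| ≤ 1) :
    ∑ s : Fin r → Fin m → Bool,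
        (∫ x, ψ x * boolSign ((formula h s).eval x) ∂(inputs h)) ^ (2 * t) ≤
      (12 * t / m : ℝ) ^ (t * r) * Fintype.card (Fin r → Fin m → Bool) := by
  have : Nonempty (Fin m) := ⟨⟨0, hm⟩⟩
  have hm0 : (0 : ℝ) < m := by exact_mod_cast hm
  simp_rw [integral_inputs h hm, boolSign_eval_formula, mul_pow]
  rw [← Finset.mul_sum]
  calc _ ≤ (((m : ℝ) ^ r)⁻¹) ^ (2 * t) * (2 ^ m * (12 * t * m) ^ t) ^ r := by
        gcongr
        refine (sum_pow_multilinear_boolSign_le (fun c => ψ (encode h c)) (fun c => hψ _) _).trans ?_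
        rw [Fintype.card_fin]
        refine pow_le_pow_left₀ (Finset.sum_nonneg fun u _ => (even_two_mul t).pow_nonneg _) ?_ _
        simpa using sum_pow_sum_boolSign_le (κ := Fin m) t ht
    _ = _ := by
        have e : (12 * t * m : ℝ) = 12 * t / m * m ^ 2 := by field_simp
        have e2 : (Fintype.card (Fin r → Fin m → Bool) : ℝ) = (2 ^ m) ^ r := by simp
        rw [e2, e, mul_pow, mul_pow (12 * t / m : ℝ), mul_pow _ _ r, ← pow_mul (12 * t / m : ℝ)]
        rw [← pow_mul (m : ℝ) 2, ← pow_mul (m : ℝ), inv_pow, ← pow_mul (m : ℝ) r,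
          mul_comm r]
        field_simp

end BlockParity

/-- Moments of order `2k` are used: the domination loss `2 ^ k` then merges with the other factors
into one `k`-th power, which decays exponentially in `k` once its base is small. -/
theorem PACLearns.two_thirds_le_of_dnf {n r m k : ℕ} (hr : 2 ^ r ≤ n) (h : r * m ≤ n) (hm : 0 < m)
    (hk : 0 < k) {Ω : Type*} [MeasurableSpace Ω] {μ : Measure Ω} [IsProbabilityMeasure μ]
    {A : Ω → SQAlg ((Fin n → Bool) × Bool) k ((Fin n → Bool) → Bool)} {q : ℕ} {τ p : ℝ}
    (hτ : 0 < τ) (hA : PACLearns (DNF.conceptClass n n) τ (1 / 2 - τ) p μ A)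
    (hq : UsesAtMost (DNF.conceptClass n n) τ A q) :
    p ≤ (q + 1) * (2 * (k : ℝ) ^ 2 * (12 * k / m) ^ r / τ ^ 2) ^ k := by
  have := BlockParity.isProbabilityMeasure_inputs h hm
  refine (hA.le_mul_of_moment hk hq hτ (BlockParity.inputs h)
    (fun s => (BlockParity.formula h s).eval)
    (fun s => ⟨_, (BlockParity.size_formula_le h s).trans hr, rfl⟩) (even_two_mul k) (by omega)
    (BlockParity.sum_pow_integral_le h hm hk)).trans (le_of_eq ?_)
  generalize (12 * k / m : ℝ) = x
  rw [div_pow, mul_pow, mul_pow, ← pow_mul, ← pow_mul, ← pow_mul, mul_comm k r,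
    mul_comm ((2 : ℝ) ^ k)]

/-! ### The lower bound -/

theorem eventually_logb_le_rpow {a : ℝ} (ha : 0 < a) :
    ∀ᶠ n : ℕ in Filter.atTop, 2 ≤ n ∧ 2 ≤ Real.logb 2 n ∧ 72 ≤ a * Real.logb 2 n ∧
      48 * Real.logb 2 n ≤ (n : ℝ) ^ (a / 2) := by
  have hlog : Filter.Tendsto (fun n : ℕ => Real.logb 2 n) Filter.atTop Filter.atTop :=
    (Real.tendsto_logb_atTop one_lt_two).comp tendsto_natCast_atTop_atTop
  have hlog2 : 0 < Real.log 2 := Real.log_pos one_lt_two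
  have ho := ((isLittleO_log_rpow_atTop (half_pos ha)).bound
    (show 0 < Real.log 2 / 48 by positivity))
  filter_upwards [Filter.eventually_ge_atTop 2, hlog.eventually_ge_atTop 2,
    hlog.eventually_ge_atTop (72 / a), tendsto_natCast_atTop_atTop.eventually ho]
    with n h1 h2 h3 h4
  refine ⟨h1, h2, ?_, ?_⟩
  · rwa [div_le_iff₀' ha] at h3
  · have h5 := (Real.le_norm_self _).trans h4
    rw [Real.norm_of_nonneg (show 0 ≤ (n : ℝ) ^ (a / 2) by positivity)] at h5
    rw [Real.logb, mul_div_assoc', div_le_iff₀ hlog2]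
    linarith

/-- The separation parameter is small when `k` is at most `2 n ^ (1 - a)`. -/
theorem two_mul_sq_mul_pow_div_le {n k : ℕ} {a β : ℝ} (ha : 0 < a) (hβa : β ≤ a / 16)
    (hn : 2 ≤ n) (hL : 2 ≤ Real.logb 2 n) (haL : 72 ≤ a * Real.logb 2 n)
    (hLa : 48 * Real.logb 2 n ≤ (n : ℝ) ^ (a / 2)) (hk : (k : ℝ) ≤ 2 * (n : ℝ) ^ (1 - a)) :
    0 < n / Nat.log 2 n ∧
      2 * (k : ℝ) ^ 2 * (12 * k / (n / Nat.log 2 n : ℕ)) ^ Nat.log 2 n /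
        ((n : ℝ) ^ (-(β * Real.logb 2 n))) ^ 2 ≤ 1 / 16 := by
  set L := Real.logb 2 n with hLdef
  set r := Nat.log 2 n with hr
  have hn0 : (0 : ℝ) < n := by positivity
  have hn1 : (1 : ℝ) ≤ n := by exact_mod_cast (by omega : 1 ≤ n)
  have hn2 : (2 : ℝ) ≤ n := by exact_mod_cast hn
  have hr1 : 1 ≤ r := Nat.log_pos one_lt_two hn
  have hr0 : (0 : ℝ) < r := by exact_mod_cast hr1
  have hpow : 2 ^ r ≤ n := Nat.pow_log_le_self 2 (by omega)
  have hrL : (r : ℝ) ≤ L := by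
    rw [hLdef, Real.le_logb_iff_rpow_le one_lt_two hn0, Real.rpow_natCast]
    exact_mod_cast hpow
  have hLr : L ≤ r + 1 := by
    rw [hLdef, Real.logb_le_iff_le_rpow one_lt_two hn0]
    have := Nat.lt_pow_succ_log_self one_lt_two n
    have h2 : ((r : ℝ) + 1) = ((r + 1 : ℕ) : ℝ) := by push_cast; ring
    rw [h2, Real.rpow_natCast]
    exact_mod_cast this.le
  have h2r : 2 * r ≤ n := by
    obtain ⟨j, hj⟩ : ∃ j, r = j + 1 := ⟨r - 1, by omega⟩
    have : j + 1 ≤ 2 ^ j := Nat.lt_two_pow_self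
    rw [hj, pow_succ] at hpow
    omega
  have hm : 0 < n / r := Nat.div_pos (by omega) hr1
  refine ⟨hm, ?_⟩
  set m := n / r with hmdef
  have hm0 : (0 : ℝ) < m := by exact_mod_cast hm
  have hnm : (n : ℝ) ≤ 2 * L * m := by
    have h1 : n < r * (m + 1) := by
      rw [mul_comm]
      exact Nat.lt_mul_of_div_lt (Nat.lt_succ_self _) hr1
    have h2 : n ≤ 2 * r * m := by nlinarith
    calc (n : ℝ) ≤ 2 * r * m := by exact_mod_cast h2
      _ ≤ 2 * L * m := by gcongr
  -- Here `k` is of order at most `n^(1-a)` and `m` at least `n/(2L)`; half of the gain `n^(-a)`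
  -- absorbs the factor `48 * L`.
  have hbase : 12 * (k : ℝ) / m ≤ (n : ℝ) ^ (-(a / 2)) := by
    have e1 : (n : ℝ) ^ (1 - a) * n ^ (a / 2) = n * n ^ (-(a / 2)) := by
      rw [← Real.rpow_add hn0, mul_comm, ← Real.rpow_add_one hn0.ne']
      congr 1; ring
    have hp1 : 0 < (n : ℝ) ^ (1 - a) := Real.rpow_pos_of_pos hn0 _
    have hp2 : 0 < (n : ℝ) ^ (-(a / 2)) := Real.rpow_pos_of_pos hn0 _
    rw [div_le_iff₀ hm0]
    have h1 : 12 * (k : ℝ) * (2 * L) ≤ n ^ (-(a / 2)) * m * (2 * L) := by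
      calc 12 * (k : ℝ) * (2 * L) ≤ 12 * (2 * (n : ℝ) ^ (1 - a)) * (2 * L) := by gcongr
        _ = (n : ℝ) ^ (1 - a) * (48 * L) := by ring
        _ ≤ (n : ℝ) ^ (1 - a) * n ^ (a / 2) := by gcongr
        _ = n * n ^ (-(a / 2)) := e1
        _ ≤ (2 * L * m) * n ^ (-(a / 2)) := by gcongr
        _ = _ := by ring
    exact le_of_mul_le_mul_right h1 (by linarith)
  have hbase_pow : (12 * (k : ℝ) / m) ^ r ≤ (n : ℝ) ^ (-(a * L / 4)) := by
    calc (12 * (k : ℝ) / m) ^ r ≤ ((n : ℝ) ^ (-(a / 2))) ^ r :=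
          pow_le_pow_left₀ (by positivity) hbase _
      _ = (n : ℝ) ^ (-(a / 2) * r) := by rw [Real.rpow_mul hn0.le, Real.rpow_natCast]
      -- Rounding costs at most a factor two in the exponent: `r ≥ L - 1 ≥ L / 2`.
      _ ≤ _ := Real.rpow_le_rpow_of_exponent_le hn1 (by nlinarith)
  have hkn : (k : ℝ) ≤ 2 * n := by
    refine hk.trans (mul_le_mul_of_nonneg_left ?_ zero_le_two)
    simpa using Real.rpow_le_rpow_of_exponent_le hn1 (show 1 - a ≤ 1 by linarith)
  have h128 : (128 : ℝ) ≤ (n : ℝ) ^ 7 := by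
    calc (128 : ℝ) = 2 ^ 7 := by norm_num
      _ ≤ _ := by gcongr
  rw [div_le_iff₀ (by positivity)]
  have hτ : ((n : ℝ) ^ (-(β * L))) ^ 2 = (n : ℝ) ^ (-(2 * β * L)) := by
    rw [← Real.rpow_natCast, ← Real.rpow_mul hn0.le]; congr 1; push_cast; ring
  have hmain : 128 * (n : ℝ) ^ 2 * n ^ (-(a * L / 4)) ≤ (n : ℝ) ^ (-(2 * β * L)) := by
    calc 128 * (n : ℝ) ^ 2 * n ^ (-(a * L / 4)) ≤ n ^ 7 * (n : ℝ) ^ 2 * n ^ (-(a * L / 4)) := by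
          gcongr
      _ = (n : ℝ) ^ ((9 : ℕ) + -(a * L / 4)) := by
          rw [Real.rpow_add hn0, Real.rpow_natCast]; ring
      -- Since `2 * β ≤ a / 8`, the exponents compare as soon as `9 ≤ a * L / 8`, which is the
      -- threshold `72`.
      _ ≤ _ := Real.rpow_le_rpow_of_exponent_le hn1 (by push_cast; nlinarith)
  rw [hτ]
  have : 32 * (k : ℝ) ^ 2 * (12 * k / m) ^ r ≤ 128 * (n : ℝ) ^ 2 * n ^ (-(a * L / 4)) := by
    calc 32 * (k : ℝ) ^ 2 * (12 * k / m) ^ r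
        ≤ 32 * (2 * (n : ℝ)) ^ 2 * n ^ (-(a * L / 4)) := by gcongr
      _ = _ := by ring
  linarith

/-- No algorithm attains a nonpositive error. -/
theorem PACLearns.error_pos {Z : Type} [MeasurableSpace Z] [Nonempty Z] {Ω : Type*}
    [MeasurableSpace Ω] {k : ℕ} {C : Set (Z → Bool)} (hC : C.Nonempty) {τ ε p : ℝ} (hτ : 0 ≤ τ)
    (hp : 0 < p) {μ : Measure Ω} {A : Ω → SQAlg (Z × Bool) k (Z → Bool)}
    (hA : PACLearns C τ ε p μ A) : 0 < ε := by
  obtain ⟨f, hf⟩ := hC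
  obtain ⟨z⟩ := ‹Nonempty Z›
  obtain ⟨E, -, hE, h⟩ := hA (Measure.dirac z) f hf
    (fun φ => ∫ x, (φ x : ℝ) ∂(Measure.pi fun _ : Fin k => labeled (Measure.dirac z) f))
    (fun φ => by simpa using hτ)
  obtain ⟨ω, hω⟩ : E.Nonempty := by
    rw [Set.nonempty_iff_ne_empty]
    rintro rfl
    simp at hE
    linarith
  exact measureReal_nonneg.trans_lt (h ω hω)

/-- The tolerance equals `2 ^ (-β (log₂ n)²)`, so a small `β` keeps it at least `1/2` on any bounded
range of `n`. -/
theorem half_le_rpow_neg_mul_logb {n N : ℕ} {β : ℝ} (hn : 1 ≤ n) (hnN : n ≤ N) (hβ0 : 0 ≤ β)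
    (hβ : β * Real.logb 2 N ^ 2 ≤ 1) : 1 / 2 ≤ (n : ℝ) ^ (-(β * Real.logb 2 n)) := by
  have hn0 : (0 : ℝ) < n := by exact_mod_cast hn
  have hL0 : 0 ≤ Real.logb 2 n := Real.logb_nonneg one_lt_two (by exact_mod_cast hn)
  have hL : Real.logb 2 n ≤ Real.logb 2 N :=
    Real.logb_le_logb_of_le one_lt_two hn0 (by exact_mod_cast hnN)
  have h1 : β * Real.logb 2 n ^ 2 ≤ 1 := le_trans (by gcongr) hβ
  have e : (n : ℝ) ^ (-(β * Real.logb 2 n)) = 2 ^ (-(β * Real.logb 2 n ^ 2)) := by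
    conv_lhs => rw [← Real.rpow_logb two_pos one_lt_two.ne' hn0]
    rw [← Real.rpow_mul zero_le_two, Real.logb_rpow two_pos one_lt_two.ne']
    congr 1; ring
  rw [e]
  calc (1 / 2 : ℝ) = 2 ^ (-1 : ℝ) := by rw [Real.rpow_neg_one]; norm_num
    _ ≤ _ := Real.rpow_le_rpow_of_exponent_le one_le_two (by linarith)

theorem theorem3 (α : ℝ) (hα : 0 < α) :
    ∃ β : ℝ, 0 < β ∧
      ∀ n : ℕ, 1 ≤ n →
        ∀ (Ω : Type*) [MeasurableSpace Ω] (μ : Measure Ω) [IsProbabilityMeasure μ]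
          (A : Ω → SQAlg ((Fin n → Bool) × Bool) ⌈(n : ℝ) ^ (1 - α)⌉₊ ((Fin n → Bool) → Bool))
          (q : ℕ),
          PACLearns (DNF.conceptClass n n) ((n : ℝ) ^ (-(β * Real.logb 2 n)))
            (1 / 2 - (n : ℝ) ^ (-(β * Real.logb 2 n))) (2 / 3) μ A →
          UsesAtMost (DNF.conceptClass n n) ((n : ℝ) ^ (-(β * Real.logb 2 n))) A q →
          (2 : ℝ) ^ ((n : ℝ) ^ (1 - α)) ≤ q := by
  -- Truncating at `1` keeps `n ^ (1 - a) ≥ 1`, so that the ceiling defining `k` costs at most a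
  -- factor `2` even when `α > 1`.
  set a := min α 1 with ha_def
  have ha : 0 < a := lt_min hα one_pos
  obtain ⟨N, hN⟩ := Filter.eventually_atTop.1 (eventually_logb_le_rpow ha)
  have hLN : 0 < Real.logb 2 N := by linarith [(hN N le_rfl).2.1]
  refine ⟨min (a / 16) (1 / Real.logb 2 N ^ 2), lt_min (by positivity) (by positivity), ?_⟩
  set β := min (a / 16) (1 / Real.logb 2 N ^ 2) with hβ_def
  have hβ : 0 < β := lt_min (by positivity) (by positivity)
  intro n hn Ω _ μ _ A q hA hq
  have hn0 : (0 : ℝ) < n := by exact_mod_cast hn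
  have hn1 : (1 : ℝ) ≤ n := by exact_mod_cast hn
  have hτ : 0 < (n : ℝ) ^ (-(β * Real.logb 2 n)) := Real.rpow_pos_of_pos hn0 _
  rcases le_total n N with hnN | hnN
  -- Here the tolerance is at least `1/2`, so the demanded error is nonpositive and no learner
  -- exists.
  · have hC : (DNF.conceptClass n n).Nonempty := ⟨_, ∅, Nat.zero_le _, rfl⟩
    have h1 := hA.error_pos hC hτ.le (by norm_num)
    have h2 := half_le_rpow_neg_mul_logb hn hnN hβ.le
      ((le_div_iff₀ (by positivity)).1 (min_le_right _ _))
    linarith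
  · obtain ⟨hn2, hL, haL, hLa⟩ := hN n hnN
    set k := ⌈(n : ℝ) ^ (1 - α)⌉₊ with hk_def
    have hk0 : 0 < k := Nat.ceil_pos.2 (Real.rpow_pos_of_pos hn0 _)
    have hk : (k : ℝ) ≤ 2 * (n : ℝ) ^ (1 - a) := by
      have h1 := (Nat.ceil_lt_add_one (Real.rpow_nonneg hn0.le (1 - α))).le
      have h2 : (n : ℝ) ^ (1 - α) ≤ (n : ℝ) ^ (1 - a) :=
        Real.rpow_le_rpow_of_exponent_le hn1 (by linarith [min_le_left α 1])
      have h3 : 1 ≤ (n : ℝ) ^ (1 - a) :=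
        Real.one_le_rpow hn1 (by linarith [min_le_right α 1])
      linarith
    obtain ⟨hm, hX⟩ := two_mul_sq_mul_pow_div_le ha (min_le_left _ _) hn2 hL haL hLa hk
    have h := PACLearns.two_thirds_le_of_dnf (Nat.pow_log_le_self 2 (by omega))
      (Nat.mul_div_le n (Nat.log 2 n)) hm hk0 hτ hA hq
    have h16 : (2 / 3 : ℝ) ≤ (q + 1) * (1 / 16) ^ k :=
      h.trans (mul_le_mul_of_nonneg_left (pow_le_pow_left₀ (by positivity) hX _) (by positivity))
    have hq16 : 2 / 3 * (16 : ℝ) ^ k ≤ q + 1 := by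
      rwa [one_div, inv_pow, ← div_eq_mul_inv, le_div_iff₀ (by positivity)] at h16
    have h8 : (8 : ℝ) ≤ 8 ^ k := by
      simpa using pow_le_pow_right₀ (show (1 : ℝ) ≤ 8 by norm_num) hk0
    have h2k : (1 : ℝ) ≤ 2 ^ k := one_le_pow₀ one_le_two
    have e : (16 : ℝ) ^ k = 2 ^ k * 8 ^ k := by rw [← mul_pow]; norm_num
    calc (2 : ℝ) ^ ((n : ℝ) ^ (1 - α)) ≤ 2 ^ (k : ℝ) :=
          Real.rpow_le_rpow_of_exponent_le one_le_two (Nat.le_ceil _)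
      _ = 2 ^ k := Real.rpow_natCast _ _
      -- From `q + 1 ≥ (2/3) * 8^k * 2^k ≥ (16/3) * 2^k` and `2^k ≥ 1`.
      _ ≤ q := by nlinarith
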